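/- Let $h:[0,\infty)\to[0,\infty)$ be measurable with $\alpha:=\int_0^\infty h(x)\,dx<1$. Let $\tau_1,\tau_2,\dots$ be i.i.d. nonnegative random variables whose common distribution has a density $f$ with respect to Lebesgue measure and a finite mean. Put $S_n=\tau_1+\dots+\tau_n$ (so $S_0=0$) and let $N_R=\sum_{n\ge0}\delta_{S_n}$ be the renewal process. A point process on $[0,\infty)$ is a random locally finite counting measure, i.e. one that is integer-valued (hence finite) on bounded Borel sets, and point processes are identified with their laws. There is a measurable family $\{N_s(\cdot\mid t):t\ge0\}$ of point processes on $[0,\infty)$ (a family whose laws depend measurably on $t$) with probability generating functional $$\mathbb E\Big[\prod_{x\in N_s(\cdot\mid t)}z(x)\Big]=\exp\Big(\int_0^\infty (z(x+t)-1)\,h(x)\,dx\Big)$$ for all measurable $z:[0,\infty)\to[0,1]$ such that $1-z$ vanishes outside a bounded set (that is, $N_s(\cdot\mid t)$ is a Poisson process with intensity $h(x-t)1_{\{x\ge t\}}\,dx$). For any such family, define the cluster of an immigrant at $t_0\ge0$ by generations: $N_c^{(0)}(\cdot\mid t_0)=\delta_{t_0}$; given the generations $0,\dots,n$, let $N_c^{(n+1)}(\cdot\mid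 t_0)$ be the superposition, over the points $t$ of $N_c^{(n)}(\cdot\mid t_0)$, of independent processes with the laws of $N_s(\cdot\mid t)$; and $N_c(\cdot\mid t_0)=\sum_{n\ge0}N_c^{(n)}(\cdot\mid t_0)$. Let $$N(\cdot)=\sum_{t_0\in N_R}N_c(\cdot\mid t_0)$$ be the independent cluster process with centre process $N_R$ and satellite processes $N_c(\cdot\mid t_0)$: given $N_R=\sum_i\delta_{y_i}$, it has the law of a sum of independent random measures with the laws of $N_c(\cdot\mid y_i)$. Then: 1. The cluster process exists: $N_R$ is almost surely a locally finite counting measure, $\{N_c(\cdot\mid t_0):t_0\ge0\}$ is a measurable family of point processes, and the superposition $N$ is a point process; in particular $N(B)<\infty$ almost surely for every bounded Borel set $B\subset[0,\infty)$. 2. The clusters are almost surely finite: for every $t_0\ge0$, $N_c([0,\infty)\mid t_0)<\infty$ almost surely. 3. For every $t_0\ge0$, $\mathbb E[N_c([0,\infty)\mid t_0)]=\dfrac1{1-\alpha}$. -/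

import Mathlib

open MeasureTheory ProbabilityTheory Set
open scoped NNReal ENNReal

namespace RenewalHawkes

/-- Lebesgue measure on the half-line `[0, ∞)`. -/
noncomputable def lebesgue : Measure ℝ≥0 := (volume : Measure ℝ).comap ((↑) : ℝ≥0 → ℝ)

/-- A locally finite counting measure on `[0, ∞)`: it takes (finite) integer values on bounded
Borel sets. -/
def IsCounting (ν : Measure ℝ≥0) : Prop :=
  ∀ B : Set ℝ≥0, MeasurableSet B → Bornology.IsBounded B → ∃ n : ℕ, ν B = n

/-- A law on the space of all measures on `[0, ∞)` (with the `σ`-field generated by the evaluations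
`ν ↦ ν B`) is the law of a point process if it is a probability law which is carried by the
locally finite counting measures. -/
def IsPointProcess (L : Measure (Measure ℝ≥0)) : Prop :=
  IsProbabilityMeasure L ∧ ∀ᵐ ν ∂L, IsCounting ν

/-- The class of test functions: measurable `z : [0, ∞) → [0, 1]` such that `1 - z` vanishes outside
some bounded set. -/
def IsTestFunction (z : ℝ≥0 → ℝ≥0) : Prop :=
  Measurable z ∧ (∀ x, z x ≤ 1) ∧ Bornology.IsBounded {x | z x ≠ 1}

/-- The probability generating functional `E [exp (∫ log z dN)]` of a law, for `z` with values in
`[0, 1]`. Here `-log z` is `[0, ∞]`-valued, with `log 0 = -∞` and `exp (-∞) = 0`. -/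
noncomputable def pgfl (L : Measure (Measure ℝ≥0)) (z : ℝ≥0 → ℝ≥0) : ℝ≥0∞ :=
  ∫⁻ ν, EReal.exp (-((∫⁻ x, (-ENNReal.log (z x)).toENNReal ∂ν : ℝ≥0∞) : EReal)) ∂L

/-- The `i`-th point (`i = 0, 1, 2, …`, in increasing order and with multiplicity) of a locally
finite counting measure `μ` on `[0, ∞)`. It is meaningful if `μ` has more than `i` points. -/
noncomputable def point (i : ℕ) (μ : Measure ℝ≥0) : ℝ≥0 :=
  sInf {t | (i : ℝ≥0∞) < μ (Iic t)}

lemma measurable_point (i : ℕ) : Measurable (point i) := by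
  refine measurable_of_Iio fun a => ?_
  have key : point i ⁻¹' Iio a =
      (⋃ q : {q : ℚ // ((q : ℝ).toNNReal) < a},
        {μ : Measure ℝ≥0 | (i : ℝ≥0∞) < μ (Iic ((q.1 : ℝ).toNNReal))}) ∪
      ({μ : Measure ℝ≥0 | μ univ ≤ (i : ℝ≥0∞)} ∩ {_μ : Measure ℝ≥0 | 0 < a}) := by
    ext μ
    simp only [mem_preimage, mem_Iio, mem_union, mem_iUnion, mem_ofPred_eq, mem_inter_iff, point]
    have hne : (i : ℝ≥0∞) < μ univ → {t | (i : ℝ≥0∞) < μ (Iic t)}.Nonempty := by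
      intro h
      have hU : (univ : Set ℝ≥0) = ⋃ n : ℕ, Iic (n : ℝ≥0) := by
        ext x
        simpa using exists_nat_ge x
      have hmono : Monotone fun n : ℕ => Iic (n : ℝ≥0) := fun m n hmn =>
        Iic_subset_Iic.2 (by exact_mod_cast hmn)
      rw [hU, hmono.measure_iUnion, lt_iSup_iff] at h
      exact ⟨_, h.choose_spec⟩
    constructor
    · intro h
      by_cases hi : (i : ℝ≥0∞) < μ univ
      · left
        obtain ⟨t, ht, hta⟩ := (csInf_lt_iff (OrderBot.bddBelow _) (hne hi)).1 h
        obtain ⟨q, hq1, hq2⟩ := exists_rat_btwn (NNReal.coe_lt_coe.2 hta)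
        have hq0 : (0 : ℝ) ≤ q := t.2.trans hq1.le
        have hqc : (((q : ℝ).toNNReal : ℝ≥0) : ℝ) = q := Real.coe_toNNReal _ hq0
        refine ⟨⟨q, NNReal.coe_lt_coe.1 (by rw [hqc]; exact hq2)⟩, ?_⟩
        refine lt_of_lt_of_le ht (measure_mono (Iic_subset_Iic.2 ?_))
        exact NNReal.coe_le_coe.1 (by rw [hqc]; exact hq1.le)
      · exact Or.inr ⟨not_lt.1 hi, (zero_le).trans_lt h⟩
    · rintro (⟨⟨q, hqa⟩, hq⟩ | ⟨hi, ha⟩)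
      · refine lt_of_le_of_lt (csInf_le (OrderBot.bddBelow _) ?_) hqa
        exact hq
      · have : {t | (i : ℝ≥0∞) < μ (Iic t)} = ∅ := by
          ext t
          simpa using (measure_mono (subset_univ _)).trans hi
        rw [this]
        simpa using ha
  rw [key]
  refine MeasurableSet.union (MeasurableSet.iUnion fun q => ?_) (MeasurableSet.inter ?_ ?_)
  · exact measurableSet_lt measurable_const (Measure.measurable_coe measurableSet_Iic)
  · exact measurableSet_le (Measure.measurable_coe MeasurableSet.univ) measurable_const
  · exact MeasurableSet.const _

/-- The law of the cluster contributed by the `i`-th point of `μ`: it is `Q y` if `y` is that point,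
and the law of the null measure if `μ` does not have more than `i` points. -/
noncomputable def summand (Q : Kernel ℝ≥0 (Measure ℝ≥0)) (i : ℕ) (μ : Measure ℝ≥0) :
    Measure (Measure ℝ≥0) :=
  open Classical in if (i : ℝ≥0∞) < μ univ then Q (point i μ) else Measure.dirac 0

instance (Q : Kernel ℝ≥0 (Measure ℝ≥0)) [IsMarkovKernel Q] (i : ℕ) (μ : Measure ℝ≥0) :
    IsProbabilityMeasure (summand Q i μ) := by
  unfold summand
  split_ifs <;> infer_instance

lemma measurable_summand (Q : Kernel ℝ≥0 (Measure ℝ≥0)) (i : ℕ) : Measurable (summand Q i) := by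
  classical
  unfold summand
  refine Measurable.ite ?_ (Q.measurable.comp (measurable_point i)) measurable_const
  exact measurableSet_lt measurable_const (Measure.measurable_coe MeasurableSet.univ)

lemma measurable_sum : Measurable (Measure.sum : (ℕ → Measure ℝ≥0) → Measure ℝ≥0) := by
  refine Measure.measurable_of_measurable_coe _ fun s hs => ?_
  simp_rw [Measure.sum_apply _ hs]
  exact Measurable.tsum fun i => (Measure.measurable_coe hs).comp (measurable_pi_apply i)

/-- For the measure `μ` with points `y₀ ≤ y₁ ≤ …`, the infinite convolution
`Q y₀ * Q y₁ * …`, i.e. the law of the sum of independent random measures with laws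
`Q y₀, Q y₁, …`, as a kernel in `μ`. -/
noncomputable def superposition (Q : Kernel ℝ≥0 (Measure ℝ≥0)) [IsMarkovKernel Q] :
    Kernel (Measure ℝ≥0) (Measure ℝ≥0) where
  toFun μ := (Measure.infinitePi fun i : ℕ => summand Q i μ).map Measure.sum
  measurable' := by
    refine (Measure.measurable_map _ measurable_sum).comp ?_
    refine Measurable.measure_of_isPiSystem_of_isProbabilityMeasure
      generateFrom_measurableCylinders.symm isPiSystem_measurableCylinders ?_
    intro s hs
    obtain ⟨I, S, hS, rfl⟩ := (mem_measurableCylinders _).1 hs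
    have hcyl : ∀ μ, Measure.infinitePi (fun i : ℕ => summand Q i μ) (cylinder I S) =
        Measure.pi (fun i : I => summand Q i μ) S := fun μ => Measure.infinitePi_cylinder _ hS
    simp_rw [hcyl]
    refine (Measure.measurable_coe hS).comp ?_
    refine Measurable.measure_of_isPiSystem_of_isProbabilityMeasure
      generateFrom_pi.symm isPiSystem_pi ?_
    rintro _ ⟨t, ht, rfl⟩
    simp_rw [Measure.pi_pi]
    exact Finset.measurable_prod _ fun i _ =>
      (Measure.measurable_coe (show MeasurableSet (t i) from ht i (mem_univ i))).comp (measurable_summand Q i)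

instance (Q : Kernel ℝ≥0 (Measure ℝ≥0)) [IsMarkovKernel Q] : IsMarkovKernel (superposition Q) :=
  ⟨fun _ => Measure.isProbabilityMeasure_map measurable_sum.aemeasurable⟩

/-- The law of the independent cluster process with centre process of law `Lc` and satellite
processes of laws `Q y`: `P (N ∈ U) = ∫ P (N_s(· | μ) ∈ U) P (N_c ∈ dμ)`. A priori it is a law on
the space of all measures on `[0, ∞)`. -/
noncomputable def clusterLaw (Lc : Measure (Measure ℝ≥0)) (Q : Kernel ℝ≥0 (Measure ℝ≥0))
    [IsMarkovKernel Q] : Measure (Measure ℝ≥0) :=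
  Lc.bind (superposition Q)

/-- The independent cluster process exists: the centre process is a point process, the satellite
processes are point processes (they form a measurable family since `Q` is a kernel), and the
superposition is a point process; in particular it is almost surely locally finite. -/
def ClusterProcessExists (Lc : Measure (Measure ℝ≥0)) (Q : Kernel ℝ≥0 (Measure ℝ≥0))
    [IsMarkovKernel Q] : Prop :=
  IsPointProcess Lc ∧ (∀ t, IsPointProcess (Q t)) ∧ IsPointProcess (clusterLaw Lc Q)

/-- `Q` is the measurable family of laws of the point processes `N_s(· | t)` of the direct offspring
of a point at `t`, determined by
`E [∏_{x ∈ N_s(· | t)} z x] = exp (∫₀^∞ (z (x + t) - 1) h x dx)` for every test function `z`. -/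
def IsOffspringFamily (h : ℝ≥0 → ℝ≥0) (Q : Kernel ℝ≥0 (Measure ℝ≥0)) : Prop :=
  ∀ t, IsPointProcess (Q t) ∧ ∀ z, IsTestFunction z →
    pgfl (Q t) z = ENNReal.ofReal (Real.exp (∫ x, ((z (x + t) : ℝ) - 1) * (h x : ℝ) ∂lebesgue))

/-- The joint law of the successive generations `(N_c^{(n)}(· | t₀))_{n ≥ 0}` of descendants of an
immigrant at `t₀`: generation `0` is `δ_{t₀}`, and given the generations up to `n`, generation
`n + 1` is the superposition of independent copies of `N_s(· | t)` over the points `t` of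
generation `n`. -/
noncomputable def generations (Q : Kernel ℝ≥0 (Measure ℝ≥0)) [IsMarkovKernel Q] :
    Kernel ℝ≥0 (ℕ → Measure ℝ≥0) :=
  (Kernel.traj (X := fun _ => Measure ℝ≥0)
    (fun n => (superposition Q).comap (fun x => x ⟨n, Finset.mem_Iic.2 le_rfl⟩)
      (measurable_pi_apply _)) 0).comap
    (fun t₀ _ => Measure.dirac t₀) (measurable_pi_lambda _ fun _ => Measure.measurable_dirac)

instance (Q : Kernel ℝ≥0 (Measure ℝ≥0)) [IsMarkovKernel Q] : IsMarkovKernel (generations Q) := by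
  unfold generations
  infer_instance

/-- The law of the complete cluster `N_c(· | t₀) = ∑_{n ≥ 0} N_c^{(n)}(· | t₀)` of an immigrant at
`t₀`, including the immigrant. -/
noncomputable def cluster (Q : Kernel ℝ≥0 (Measure ℝ≥0)) [IsMarkovKernel Q] :
    Kernel ℝ≥0 (Measure ℝ≥0) :=
  (generations Q).map Measure.sum

instance (Q : Kernel ℝ≥0 (Measure ℝ≥0)) [IsMarkovKernel Q] : IsMarkovKernel (cluster Q) :=
  Kernel.IsMarkovKernel.map _ measurable_sum

/-- `τ` is a sequence of i.i.d. interarrival times in `[0, ∞)` whose common distribution has a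
density `f` with respect to Lebesgue measure and a finite mean. -/
structure IsInterarrivalSequence {Ω : Type*} [MeasurableSpace Ω] (P : Measure Ω)
    (τ : ℕ → Ω → ℝ≥0) (f : ℝ≥0 → ℝ≥0) : Prop where
  measurable : ∀ i, Measurable (τ i)
  indep : iIndepFun τ P
  measurable_density : Measurable f
  law : ∀ i, P.map (τ i) = lebesgue.withDensity fun x => (f x : ℝ≥0∞)
  finite_mean : ∫⁻ x, (x : ℝ≥0∞) * (f x : ℝ≥0∞) ∂lebesgue < ∞

/-- The renewal process `N_R = ∑_{n ≥ 0} δ_{S_n}`, where `S_0 = 0` and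
`S_n` is the sum of the first `n` interarrival times. -/
noncomputable def renewalProcess {Ω : Type*} (τ : ℕ → Ω → ℝ≥0) (ω : Ω) : Measure ℝ≥0 :=
  Measure.sum fun n : ℕ => Measure.dirac (∑ i ∈ Finset.range n, τ i ω)

end RenewalHawkes

namespace RenewalHawkes

/-! ### Counting measures -/

/-! Everything about the clusters is a first-moment computation. The probability generating
functional enters only through the mean measure: tested on `c` on `B` and `1` elsewhere, it is the
generating function of the number of points in `B`, and its slope at `c = 1` is the mean number
(`lintegral_of_pgfl_step`). Hence an individual at `t` has `α` children on average and none before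
`t`. These two facts, with integer-valuedness, are all that the cluster argument uses.

Linearity of expectation multiplies the mean by `α` at each generation
(`lintegral_superposition_univ`), so generation `n` has mean size `α ^ n`
(`generationLaw_properties`). The geometric series gives mean cluster size `(1 - α)⁻¹`. This is
finite as `α < 1`, so clusters are almost surely finite, and a sum of counting measures that is
finite on bounded sets is a counting measure.

A cluster does not reach back before its immigrant, so only the finitely many immigrants in `[0, r]`
put points there, each with mean at most `(1 - α)⁻¹` (`lintegral_superposition_Iic_lt_top`). That
there are finitely many follows from the Laplace transform: `E exp (-S_n)` is the `n`-th power of a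
number below `1`, hence summable (`isPointProcess_renewalProcess`). An offspring family is obtained
from an explicit finite Poisson process (`poissonFamily`). -/

/-- A convergent sum has only finitely many terms that are at least `1`, and an integer term below
`1` vanishes. -/
lemma exists_nat_eq_tsum {a : ℕ → ℝ≥0∞} (ha : ∀ i, ∃ n : ℕ, a i = n) (hs : ∑' i, a i ≠ ∞) :
    ∃ n : ℕ, ∑' i, a i = n := by
  choose b hb using ha
  have hfin : {i | 1 ≤ a i}.Finite := ENNReal.finite_const_le_of_tsum_ne_top hs one_ne_zero
  refine ⟨∑ i ∈ hfin.toFinset, b i, ?_⟩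
  rw [tsum_eq_sum (s := hfin.toFinset)]
  · push_cast
    exact Finset.sum_congr rfl fun i _ => hb i
  · intro i hi
    have : ¬ 1 ≤ a i := by simpa using hi
    rw [hb i] at this ⊢
    have : b i < 1 := by exact_mod_cast not_le.1 this
    simp [Nat.lt_one_iff.1 this]

lemma nnreal_borel_eq_generateFrom_Iio_rat :
    (inferInstance : MeasurableSpace ℝ≥0) =
      .generateFrom (range fun q : ℚ => Iio ((q : ℝ).toNNReal)) := by
  refine le_antisymm ?_ ?_
  · rw [show (inferInstance : MeasurableSpace ℝ≥0) = borel ℝ≥0 from BorelSpace.measurable_eq,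
      borel_eq_generateFrom_Iio]
    refine MeasurableSpace.generateFrom_le ?_
    rintro _ ⟨a, rfl⟩
    have : Iio a = ⋃ q : {q : ℚ // (q : ℝ).toNNReal ≤ a}, Iio ((q.1 : ℝ).toNNReal) := by
      ext x
      simp only [mem_Iio, mem_iUnion]
      constructor
      · intro h
        obtain ⟨q, h1, h2⟩ := exists_rat_btwn (NNReal.coe_lt_coe.2 h)
        refine ⟨⟨q, Real.toNNReal_le_iff_le_coe.2 h2.le⟩, Real.lt_toNNReal_iff_coe_lt.2 h1⟩
      · rintro ⟨q, hq⟩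
        exact hq.trans_le q.2
    rw [this]
    exact MeasurableSet.iUnion fun q => MeasurableSpace.measurableSet_generateFrom ⟨q.1, rfl⟩
  · refine MeasurableSpace.generateFrom_le ?_
    rintro _ ⟨q, rfl⟩
    exact measurableSet_Iio

/-- A Dynkin-class argument inside `[0, N)`, where `ν` is finite: complements give differences of
finite integers, disjoint unions give finite sums of integers. Rational endpoints reduce the
property to countably many conditions. -/
lemma isCounting_of_Iio {ν : Measure ℝ≥0}
    (hν : ∀ q : ℚ, ∃ n : ℕ, ν (Iio ((q : ℝ).toNNReal)) = n) : IsCounting ν := by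
  have key : ∀ N : ℕ, ∀ B : Set ℝ≥0, MeasurableSet B → ∃ n : ℕ, ν (B ∩ Iio (N : ℝ≥0)) = n := by
    intro N
    have hN : ∃ n : ℕ, ν (Iio (N : ℝ≥0)) = n := by simpa using hν N
    have hfin : ∀ s, ν (s ∩ Iio (N : ℝ≥0)) ≠ ∞ := fun s => by
      obtain ⟨n, hn⟩ := hN
      exact ((measure_mono inter_subset_right).trans_lt (by rw [hn]; simp)).ne
    refine MeasurableSpace.induction_on_inter nnreal_borel_eq_generateFrom_Iio_rat
      ?_ ⟨0, by simp⟩ ?_ ?_ ?_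
    · rintro _ ⟨p, rfl⟩ _ ⟨q, rfl⟩ _
      refine ⟨min p q, ?_⟩
      simp only [Iio_inter_Iio]
      congr 1
      push_cast
      exact (Monotone.map_min fun _ _ h => Real.toNNReal_le_toNNReal h)
    · rintro _ ⟨q, rfl⟩
      rw [Iio_inter_Iio]
      rcases min_choice ((q : ℝ).toNNReal) (N : ℝ≥0) with h | h <;> rw [h]
      · exact hν q
      · exact hN
    · intro t ht ⟨n, hn⟩
      obtain ⟨m, hm⟩ := hN
      have h1 := measure_inter_add_sdiff (μ := ν) (Iio (N : ℝ≥0)) ht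
      rw [show Iio (N : ℝ≥0) \ t = tᶜ ∩ Iio (N : ℝ≥0) by rw [sdiff_eq, inter_comm],
        inter_comm _ t, hn, hm] at h1
      refine ⟨m - n, ?_⟩
      rw [ENNReal.natCast_sub, ← h1]
      exact (ENNReal.add_sub_cancel_left (by simp)).symm
    · intro f hd hf h
      have hu : ν ((⋃ i, f i) ∩ Iio (N : ℝ≥0)) = ∑' i, ν (f i ∩ Iio (N : ℝ≥0)) := by
        rw [iUnion_inter, measure_iUnion]
        · exact fun i j hij => (hd hij).mono inter_subset_left inter_subset_left
        · exact fun i => (hf i).inter measurableSet_Iio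
      rw [hu]
      exact exists_nat_eq_tsum h (hu ▸ hfin _)
  intro B hB hb
  obtain ⟨r, hr⟩ := hb.bddAbove
  obtain ⟨N, hN⟩ := exists_nat_gt r
  have : B ∩ Iio (N : ℝ≥0) = B := inter_eq_left.2 fun x hx => (hr hx).trans_lt hN
  simpa [this] using key N B hB

lemma nnreal_isBounded_Iic (a : ℝ≥0) : Bornology.IsBounded (Iic a) :=
  (Metric.isBounded_Icc 0 a).subset fun _ hx => ⟨zero_le, hx⟩

lemma nnreal_isBounded_Iio (a : ℝ≥0) : Bornology.IsBounded (Iio a) :=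
  (nnreal_isBounded_Iic a).subset Iio_subset_Iic_self

/-- Needed to carry almost sure statements through push-forwards, Dirac laws and compositions of
kernels. -/
lemma measurableSet_isCounting : MeasurableSet {ν : Measure ℝ≥0 | IsCounting ν} := by
  have : {ν : Measure ℝ≥0 | IsCounting ν} = ⋂ q : ℚ,
      (fun ν : Measure ℝ≥0 => ν (Iio ((q : ℝ).toNNReal))) ⁻¹' range ((↑) : ℕ → ℝ≥0∞) := by
    ext ν
    simp only [mem_ofPred_eq, mem_iInter, mem_preimage, mem_range]
    constructor
    · intro h q
      obtain ⟨n, hn⟩ := h _ measurableSet_Iio (nnreal_isBounded_Iio ((q : ℝ).toNNReal))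
      exact ⟨n, hn.symm⟩
    · intro h
      exact isCounting_of_Iio fun q => (h q).imp fun n hn => hn.symm
  rw [this]
  exact MeasurableSet.iInter fun q =>
    (Measure.measurable_coe measurableSet_Iio) (countable_range _).measurableSet

lemma isCounting_sum {m : ℕ → Measure ℝ≥0} (hm : ∀ i, IsCounting (m i))
    (hf : ∀ n : ℕ, Measure.sum m (Iic (n : ℝ≥0)) < ∞) : IsCounting (Measure.sum m) := by
  intro B hB hb
  obtain ⟨r, hr⟩ := hb.bddAbove
  obtain ⟨N, hN⟩ := exists_nat_ge r
  have hlt : Measure.sum m B ≠ ∞ :=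
    ((measure_mono fun x hx => (hr hx).trans hN).trans_lt (hf N)).ne
  rw [Measure.sum_apply _ hB] at hlt ⊢
  exact exists_nat_eq_tsum (fun i => hm i B hB hb) hlt

lemma isCounting_dirac (t : ℝ≥0) : IsCounting (Measure.dirac t) := by
  intro B hB _
  by_cases h : t ∈ B
  · exact ⟨1, by simp [h]⟩
  · exact ⟨0, by simp [hB, h]⟩

lemma isCounting_zero : IsCounting 0 := fun _ _ _ => ⟨0, by simp⟩

/-- The half-line is unbounded, so it is cut into the bounded cells on which the integer part is
constant. -/
lemma IsCounting.exists_nat_univ {ν : Measure ℝ≥0} (hν : IsCounting ν) (hf : ν univ < ∞) :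
    ∃ n : ℕ, ν univ = n := by
  have hu : (univ : Set ℝ≥0) = ⋃ k : ℕ, (fun x : ℝ≥0 => ⌊x⌋₊) ⁻¹' {k} := by
    ext x; simp
  have hmeas : ∀ k : ℕ, MeasurableSet ((fun x : ℝ≥0 => ⌊x⌋₊) ⁻¹' {k}) := fun k =>
    Nat.measurable_floor (measurableSet_singleton k)
  have hs : ν univ = ∑' k : ℕ, ν ((fun x : ℝ≥0 => ⌊x⌋₊) ⁻¹' {k}) := by
    rw [hu, measure_iUnion _ hmeas]
    exact fun i j hij => Disjoint.preimage _ (by simpa using hij)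
  rw [hs]
  refine exists_nat_eq_tsum (fun k => hν _ (hmeas k) ?_) (hs ▸ hf.ne)
  refine (nnreal_isBounded_Iic ((k : ℝ≥0) + 1)).subset fun x hx => ?_
  have : ⌊x⌋₊ = k := hx
  rw [← this]
  exact (Nat.lt_floor_add_one x).le

lemma nonempty_setOf_lt_measure_Iic {μ : Measure ℝ≥0} {c : ℝ≥0∞} (hc : c < μ univ) :
    {t | c < μ (Iic t)}.Nonempty := by
  have hU : (univ : Set ℝ≥0) = ⋃ n : ℕ, Iic (n : ℝ≥0) := by
    ext x
    simpa using exists_nat_ge x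
  have hmono : Monotone fun n : ℕ => Iic (n : ℝ≥0) := fun m n hmn =>
    Iic_subset_Iic.2 (by exact_mod_cast hmn)
  rw [hU, hmono.measure_iUnion, lt_iSup_iff] at hc
  exact ⟨_, hc.choose_spec⟩

lemma le_point {μ : Measure ℝ≥0} {t : ℝ≥0} (hμ : μ (Iio t) = 0) {i : ℕ}
    (hi : (i : ℝ≥0∞) < μ univ) : t ≤ point i μ := by
  by_contra! hlt
  obtain ⟨s, hs, hst⟩ :=
    (csInf_lt_iff (OrderBot.bddBelow _) (nonempty_setOf_lt_measure_Iic hi)).1 hlt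
  have : μ (Iic s) = 0 := measure_mono_null (Iic_subset_Iio.2 hst) hμ
  have hs' : (i : ℝ≥0∞) < μ (Iic s) := hs
  simp [this] at hs'

lemma lt_measure_Iic_of_point_lt {μ : Measure ℝ≥0} {i : ℕ} (hi : (i : ℝ≥0∞) < μ univ) {t : ℝ≥0}
    (ht : point i μ < t) : (i : ℝ≥0∞) < μ (Iic t) := by
  by_contra! hle
  obtain ⟨s, hs, hst⟩ :=
    (csInf_lt_iff (OrderBot.bddBelow _) (nonempty_setOf_lt_measure_Iic hi)).1 ht
  exact absurd (lt_of_lt_of_le hs (measure_mono (Iic_subset_Iic.2 hst.le))) (not_lt.2 hle)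

lemma tsum_ite_lt_natCast (n : ℕ) (c : ℝ≥0∞) :
    ∑' i : ℕ, (if (i : ℝ≥0∞) < n then c else 0) = n * c := by
  rw [tsum_eq_sum (s := Finset.range n)]
  · rw [Finset.sum_congr rfl fun i hi => if_pos (by exact_mod_cast Finset.mem_range.1 hi)]
    simp
  · intro i hi
    exact if_neg (by exact_mod_cast fun h => hi (Finset.mem_range.2 h))

/-! ### Superpositions -/

variable {Q : Kernel ℝ≥0 (Measure ℝ≥0)} [IsMarkovKernel Q]

/-- Linearity of expectation: only the marginals of the product law matter, not independence. -/
lemma lintegral_superposition (μ : Measure ℝ≥0) {B : Set ℝ≥0} (hB : MeasurableSet B) :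
    ∫⁻ ν, ν B ∂(superposition Q μ) = ∑' i, ∫⁻ ν, ν B ∂(summand Q i μ) := by
  change ∫⁻ ν, ν B ∂((Measure.infinitePi fun i : ℕ => summand Q i μ).map Measure.sum) = _
  rw [lintegral_map (Measure.measurable_coe hB) measurable_sum]
  simp_rw [Measure.sum_apply _ hB]
  have hm : ∀ i : ℕ, Measurable fun m : ℕ → Measure ℝ≥0 => m i B := fun i =>
    (Measure.measurable_coe hB).comp (measurable_pi_apply i)
  rw [lintegral_tsum fun i => (hm i).aemeasurable]
  refine tsum_congr fun i => ?_
  rw [← lintegral_map (f := fun ν : Measure ℝ≥0 => ν B) (Measure.measurable_coe hB)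
    (measurable_pi_apply i)]
  exact congrArg (fun m => ∫⁻ ν : Measure ℝ≥0, ν B ∂m) (Measure.infinitePi_map_eval _ i)

lemma ae_isCounting_superposition (hQ : ∀ t, ∀ᵐ ν ∂Q t, IsCounting ν) (μ : Measure ℝ≥0)
    (hf : ∀ n : ℕ, ∫⁻ ν, ν (Iic (n : ℝ≥0)) ∂(superposition Q μ) < ∞) :
    ∀ᵐ ν ∂(superposition Q μ), IsCounting ν := by
  have h1 : ∀ᵐ ν ∂(superposition Q μ), ∀ n : ℕ, ν (Iic (n : ℝ≥0)) < ∞ :=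
    ae_all_iff.2 fun n => ae_lt_top (Measure.measurable_coe measurableSet_Iic) (hf n).ne
  have hsum : ∀ i, ∀ᵐ ν ∂(summand Q i μ), IsCounting ν := fun i => by
    unfold summand
    split_ifs
    · exact hQ _
    · rw [ae_dirac_iff measurableSet_isCounting]
      exact isCounting_zero
  have h2 : ∀ᵐ m ∂(Measure.infinitePi fun i : ℕ => summand Q i μ), ∀ i, IsCounting (m i) := by
    refine ae_all_iff.2 fun i => ?_
    have := hsum i
    rw [← Measure.infinitePi_map_eval (fun i : ℕ => summand Q i μ) i] at this
    exact ae_of_ae_map (measurable_pi_apply i).aemeasurable this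
  change ∀ᵐ ν ∂((Measure.infinitePi fun i : ℕ => summand Q i μ).map Measure.sum), IsCounting ν
  rw [ae_map_iff measurable_sum.aemeasurable measurableSet_isCounting]
  have h1' := ae_of_ae_map measurable_sum.aemeasurable h1
  filter_upwards [h1', h2] with m hm1 hm2 using isCounting_sum hm2 hm1

/-- Conditional form of Wald's identity: exactly `μ univ` of the summands are genuine clusters, the
others are null. -/
lemma lintegral_superposition_univ {a : ℝ≥0∞} (hQ : ∀ t, ∫⁻ ν, ν univ ∂Q t = a)
    {μ : Measure ℝ≥0} (hμ : IsCounting μ) (hf : μ univ < ∞) :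
    ∫⁻ ν, ν univ ∂(superposition Q μ) = μ univ * a := by
  rw [lintegral_superposition μ MeasurableSet.univ]
  obtain ⟨n, hn⟩ := hμ.exists_nat_univ hf
  rw [hn, ← tsum_ite_lt_natCast]
  refine tsum_congr fun i => ?_
  unfold summand
  rw [hn]
  split_ifs
  · exact hQ _
  · simp [lintegral_dirac' _ (Measure.measurable_coe MeasurableSet.univ)]

lemma ae_superposition_Iio_eq_zero (hQ : ∀ t, ∀ᵐ ν ∂Q t, ν (Iio t) = 0) {μ : Measure ℝ≥0}
    {t : ℝ≥0} (hμ : μ (Iio t) = 0) : ∀ᵐ ν ∂(superposition Q μ), ν (Iio t) = 0 := by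
  have hm := Measure.measurable_coe (α := ℝ≥0) (measurableSet_Iio (a := t))
  refine (lintegral_eq_zero_iff hm).1 ?_
  rw [lintegral_superposition μ measurableSet_Iio, ENNReal.tsum_eq_zero]
  intro i
  unfold summand
  split_ifs with h
  · refine (lintegral_eq_zero_iff hm).2 ?_
    filter_upwards [hQ (point i μ)] with ν hν
    exact measure_mono_null (Iio_subset_Iio (le_point hμ h)) hν
  · simp [lintegral_dirac' _ hm]

/-- A centre beyond `r` contributes nothing to `[0, r]`, and only finitely many centres are at most
`r`. Total mass of `μ` may be infinite, as for the renewal process. -/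
lemma lintegral_superposition_Iic_lt_top {a : ℝ≥0∞} (ha : a ≠ ∞)
    (hQ : ∀ t, ∫⁻ ν, ν univ ∂Q t ≤ a) (hQ0 : ∀ t, ∀ᵐ ν ∂Q t, ν (Iio t) = 0)
    {μ : Measure ℝ≥0} (hμ : IsCounting μ) (r : ℝ≥0) :
    ∫⁻ ν, ν (Iic r) ∂(superposition Q μ) < ∞ := by
  have hm := Measure.measurable_coe (α := ℝ≥0) (measurableSet_Iic (a := r))
  -- The margin `r + 1` turns `point i μ ≤ r` into the strict inequality required by
  -- `lt_measure_Iic_of_point_lt`.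
  obtain ⟨n, hn⟩ := hμ _ measurableSet_Iic (nnreal_isBounded_Iic (r + 1))
  rw [lintegral_superposition μ measurableSet_Iic]
  refine lt_of_le_of_lt (b := ∑' i : ℕ, (if (i : ℝ≥0∞) < n then a else 0)) ?_ ?_
  · refine ENNReal.tsum_le_tsum fun i => ?_
    unfold summand
    by_cases h : (i : ℝ≥0∞) < μ univ
    · rw [if_pos h]
      by_cases hp : point i μ ≤ r
      · rw [if_pos (hn ▸ lt_measure_Iic_of_point_lt h (hp.trans_lt (by simp)))]
        exact (lintegral_mono fun ν => measure_mono (subset_univ _)).trans (hQ _)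
      · have : ∫⁻ ν, ν (Iic r) ∂Q (point i μ) = 0 := by
          refine (lintegral_eq_zero_iff hm).2 ?_
          filter_upwards [hQ0 (point i μ)] with ν hν
          exact measure_mono_null (Iic_subset_Iio.2 (not_le.1 hp)) hν
        simp [this]
    · rw [if_neg h]
      simp [lintegral_dirac' _ hm]
  · rw [tsum_ite_lt_natCast]
    exact ENNReal.mul_lt_top (by simp) ha.lt_top

/-! ### The probability generating functional -/

/-- The function `a ↦ exp (-a)` on `[0, ∞]`. -/
noncomputable def expNeg (a : ℝ≥0∞) : ℝ≥0∞ := EReal.exp (-(a : EReal))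

lemma expNeg_eq_inv (a : ℝ≥0∞) : expNeg a = (EReal.exp a)⁻¹ := EReal.exp_neg _

lemma expNeg_zero : expNeg 0 = 1 := by simp [expNeg]

lemma expNeg_add (a b : ℝ≥0∞) : expNeg (a + b) = expNeg a * expNeg b := by
  simp_rw [expNeg_eq_inv, EReal.coe_ennreal_add, EReal.exp_add]
  refine ENNReal.mul_inv (Or.inl ?_) (Or.inr ?_) <;>
  exact (EReal.zero_lt_exp_iff.2 (EReal.bot_lt_coe_ennreal _)).ne'

lemma expNeg_natCast_mul (n : ℕ) (a : ℝ≥0∞) : expNeg (n * a) = expNeg a ^ n := by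
  induction n with
  | zero => simp [expNeg_zero]
  | succ n ih => rw [Nat.cast_succ, add_mul, one_mul, expNeg_add, ih, pow_succ]

lemma expNeg_sum {ι : Type*} (s : Finset ι) (a : ι → ℝ≥0∞) :
    expNeg (∑ i ∈ s, a i) = ∏ i ∈ s, expNeg (a i) := by
  classical
  induction s using Finset.induction_on with
  | empty => simp [expNeg_zero]
  | insert i s hi ih => rw [Finset.sum_insert hi, Finset.prod_insert hi, expNeg_add, ih]

lemma expNeg_neg_log {c : ℝ≥0} (hc : c ≤ 1) : expNeg (-ENNReal.log c).toENNReal = c := by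
  have h : 0 ≤ -ENNReal.log c := by
    rw [EReal.neg_nonneg, ← ENNReal.log_one, ENNReal.log_le_log_iff]
    exact_mod_cast hc
  rw [expNeg, EReal.coe_toENNReal h, neg_neg, ENNReal.exp_log]

lemma lintegral_neg_log_step (ν : Measure ℝ≥0) {B : Set ℝ≥0} [DecidablePred (· ∈ B)]
    (hB : MeasurableSet B) (c : ℝ≥0) :
    ∫⁻ x, (-ENNReal.log ((if x ∈ B then c else 1 : ℝ≥0) : ℝ≥0∞)).toENNReal ∂ν =
      ν B * (-ENNReal.log c).toENNReal := by
  have : (fun x => (-ENNReal.log ((if x ∈ B then c else 1 : ℝ≥0) : ℝ≥0∞)).toENNReal) =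
      B.indicator fun _ => (-ENNReal.log c).toENNReal := by
    ext x
    by_cases hx : x ∈ B <;> simp [hx]
  rw [this, lintegral_indicator_const hB, mul_comm]

/-- This is the difference quotient at `0` of `x ↦ -exp (-(m * x))`, taken along `x = 1 / (k + 1)`.
-/
lemma tendsto_mul_one_sub_exp (m : ℝ) :
    Filter.Tendsto (fun k : ℕ => ((k : ℝ) + 1) * (1 - Real.exp (-(m / (k + 1)))))
      Filter.atTop (nhds m) := by
  have hd : HasDerivAt (fun x : ℝ => -Real.exp (-(m * x))) m 0 := by
    have h1 : HasDerivAt (fun x : ℝ => -(m * x)) (-m) 0 := by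
      simpa using ((hasDerivAt_id (0 : ℝ)).const_mul m).fun_neg
    simpa using h1.exp.fun_neg
  have ht : Filter.Tendsto (fun k : ℕ => 1 / ((k : ℝ) + 1)) Filter.atTop (nhdsWithin 0 {0}ᶜ) :=
    tendsto_nhdsWithin_iff.2 ⟨tendsto_one_div_add_atTop_nhds_zero_nat,
      Filter.Eventually.of_forall fun k => by
        simp only [mem_compl_iff, mem_singleton_iff]; positivity⟩
  refine (hd.tendsto_slope_zero.comp ht).congr fun k => ?_
  simp only [Function.comp, zero_add, smul_eq_mul, mul_zero, neg_zero, Real.exp_zero,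
    div_eq_mul_inv, one_mul, inv_inv]
  ring

/-- The mean number of points in a bounded set is the derivative at `1` of the generating
function of the number of points. -/
lemma lintegral_of_pgfl_step {L : Measure (Measure ℝ≥0)} (hL : IsPointProcess L) {B : Set ℝ≥0}
    [DecidablePred (· ∈ B)] (hB : MeasurableSet B) (hb : Bornology.IsBounded B) {m : ℝ}
    (hp : ∀ c : ℝ≥0, c ≤ 1 → pgfl L (fun x => if x ∈ B then c else 1) =
      ENNReal.ofReal (Real.exp (-((1 - c) * m)))) :
    ∫⁻ ν, ν B ∂L = ENNReal.ofReal m := by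
  have := hL.1
  -- Chosen so that `c k` increases to `1` with `1 - c k = 1 / (k + 1)`.
  set c : ℕ → ℝ≥0 := fun k => (k : ℝ≥0) / (k + 1) with hcdef
  have hc1 : ∀ k, c k ≤ 1 := fun k => div_le_one_of_le₀ (by simp) zero_le
  have hcr : ∀ k, ((c k : ℝ≥0) : ℝ) = 1 - 1 / ((k : ℝ) + 1) := fun k => by
    simp only [hcdef]
    push_cast
    field_simp
    ring
  have hcmono : Monotone c := fun k l hkl => by
    rw [← NNReal.coe_le_coe, hcr, hcr]
    have : (k : ℝ) ≤ l := by exact_mod_cast hkl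
    gcongr
  -- When `ν B = n`, this is the difference quotient `(1 - c ^ n) / (1 - c)` written as a geometric
  -- sum. In that form it visibly increases to `n` with `k`, so monotone convergence replaces
  -- differentiation under the expectation.
  set F : ℕ → Measure ℝ≥0 → ℝ≥0∞ := fun k ν =>
    ∑' j : ℕ, if (j : ℝ≥0∞) < ν B then (c k : ℝ≥0∞) ^ j else 0 with hF
  have hFn : ∀ k ν (n : ℕ), ν B = (n : ℝ≥0∞) → F k ν = ∑ j ∈ Finset.range n, (c k : ℝ≥0∞) ^ j := by
    intro k ν n hn
    simp only [hF, hn]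
    rw [tsum_eq_sum (s := Finset.range n)]
    · exact Finset.sum_congr rfl fun i hi => if_pos (by exact_mod_cast Finset.mem_range.1 hi)
    · intro i hi
      exact if_neg (by exact_mod_cast fun h => hi (Finset.mem_range.2 h))
  have hFm : ∀ k, Measurable (F k) := fun k => Measurable.tsum fun j =>
    Measurable.ite (measurableSet_lt measurable_const (Measure.measurable_coe hB))
      measurable_const measurable_const
  have hnat : ∀ᵐ ν ∂L, ∃ n : ℕ, ν B = (n : ℝ≥0∞) := hL.2.mono fun ν hν => hν B hB hb
  have hone : ∀ k, (∫⁻ ν, F k ν ∂L) =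
      ENNReal.ofReal (((k : ℝ) + 1) * (1 - Real.exp (-(m / (k + 1))))) := by
    intro k
    have hk0 : ((k : ℝ≥0∞) + 1) ≠ 0 := by positivity
    have hkt : ((k : ℝ≥0∞) + 1) ≠ ∞ := by finiteness
    -- The expectation of `c ^ n + (1 - c) * ∑ j < n, c ^ j = 1`; stated additively to avoid
    -- subtraction in `ℝ≥0∞`.
    have h1 : pgfl L (fun x => if x ∈ B then c k else 1) +
        ((k : ℝ≥0∞) + 1)⁻¹ * ∫⁻ ν, F k ν ∂L = 1 := by
      rw [← lintegral_const_mul _ (hFm k), pgfl, ← lintegral_add_right _ ((hFm k).const_mul _)]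
      have htot : ∫⁻ _, 1 ∂L = 1 := by simp
      refine (lintegral_congr_ae ?_).trans htot
      filter_upwards [hnat] with ν ⟨n, hn⟩
      rw [lintegral_neg_log_step ν hB, hn, hFn k ν n hn]
      change expNeg _ + _ = _
      rw [expNeg_natCast_mul, expNeg_neg_log (hc1 k)]
      have hreal : (c k) ^ n + ((k : ℝ≥0) + 1)⁻¹ * ∑ j ∈ Finset.range n, (c k) ^ j = 1 := by
        rw [← NNReal.coe_inj]
        push_cast
        have hg := mul_neg_geom_sum (c k : ℝ) n
        rw [show (1 : ℝ) - c k = ((k : ℝ) + 1)⁻¹ by rw [hcr]; ring] at hg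
        rw [hg]; ring
      have := congrArg ((↑) : ℝ≥0 → ℝ≥0∞) hreal
      push_cast at this
      rwa [ENNReal.coe_inv (by positivity)] at this
    rw [hp _ (hc1 k), hcr] at h1
    have h2 : ((k : ℝ≥0∞) + 1)⁻¹ * ∫⁻ ν, F k ν ∂L =
        ENNReal.ofReal (1 - Real.exp (-(m / (k + 1)))) := by
      rw [show -((1 - (1 - 1 / ((k : ℝ) + 1))) * m) = -(m / (k + 1)) by ring] at h1
      rw [ENNReal.ofReal_sub _ (Real.exp_pos _).le, ENNReal.ofReal_one]
      exact ENNReal.eq_sub_of_add_eq ENNReal.ofReal_ne_top (by rw [add_comm, h1])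
    rw [ENNReal.ofReal_mul (by positivity), ← h2, ← mul_assoc,
      show ENNReal.ofReal ((k : ℝ) + 1) = (k : ℝ≥0∞) + 1 by
        rw [ENNReal.ofReal_add (by positivity) zero_le_one]; simp,
      ENNReal.mul_inv_cancel hk0 hkt, one_mul]
  have hc_tend : Filter.Tendsto (fun k => (c k : ℝ≥0∞)) Filter.atTop (nhds 1) := by
    rw [← ENNReal.coe_one, ENNReal.tendsto_coe, ← NNReal.tendsto_coe]
    simp_rw [hcr]
    simpa using tendsto_one_div_add_atTop_nhds_zero_nat.const_sub (1 : ℝ)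
  have hlim : Filter.Tendsto (fun k => ∫⁻ ν, F k ν ∂L) Filter.atTop (nhds (∫⁻ ν, ν B ∂L)) := by
    refine lintegral_tendsto_of_tendsto_of_monotone (fun k => (hFm k).aemeasurable) ?_ ?_
    · filter_upwards with ν k l hkl
      refine ENNReal.tsum_le_tsum fun j => ?_
      have := hcmono hkl
      split_ifs
      · gcongr
      · exact le_rfl
    · filter_upwards [hnat] with ν ⟨n, hn⟩
      simp_rw [fun k => hFn k ν n hn, hn]
      have h1 : (n : ℝ≥0∞) = ∑ j ∈ Finset.range n, (1 : ℝ≥0∞) ^ j := by simp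
      rw [h1]
      exact tendsto_finsetSum _ fun j _ => ENNReal.Tendsto.pow hc_tend
  simp_rw [hone] at hlim
  exact tendsto_nhds_unique hlim (ENNReal.tendsto_ofReal (tendsto_mul_one_sub_exp m))

/-! ### The offspring processes -/

section Offspring

variable {h : ℝ≥0 → ℝ≥0} {Q : Kernel ℝ≥0 (Measure ℝ≥0)}

lemma integrable_fertility (hh : Measurable h) (hα : ∫⁻ x, (h x : ℝ≥0∞) ∂lebesgue < ∞) :
    Integrable (fun x => (h x : ℝ)) lebesgue := by
  refine ⟨hh.coe_nnreal_real.aestronglyMeasurable, ?_⟩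
  simpa [HasFiniteIntegral] using hα

lemma IsOffspringFamily.lintegral_apply (hQ : IsOffspringFamily h Q) (hh : Measurable h)
    (hα : ∫⁻ x, (h x : ℝ≥0∞) ∂lebesgue < ∞) (t : ℝ≥0) {B : Set ℝ≥0} (hB : MeasurableSet B)
    (hb : Bornology.IsBounded B) :
    ∫⁻ ν, ν B ∂Q t = ∫⁻ x in {x | x + t ∈ B}, (h x : ℝ≥0∞) ∂lebesgue := by
  classical
  have hA : MeasurableSet {x : ℝ≥0 | x + t ∈ B} := (measurable_add_const t) hB
  have hint := integrable_fertility hh hα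
  rw [lintegral_of_pgfl_step (hQ t).1 hB hb
    (m := ∫ x in {x : ℝ≥0 | x + t ∈ B}, (h x : ℝ) ∂lebesgue)]
  · rw [ofReal_integral_eq_lintegral_ofReal hint.integrableOn
      (Filter.Eventually.of_forall fun x => NNReal.coe_nonneg _)]
    simp
  · intro c hc
    have hz : IsTestFunction fun x => if x ∈ B then c else 1 := by
      refine ⟨Measurable.ite hB measurable_const measurable_const, fun x => ?_, hb.subset ?_⟩
      · dsimp only
        split_ifs
        exacts [hc, le_rfl]
      · intro x hx
        by_contra hxB
        simp [hxB] at hx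
    rw [(hQ t).2 _ hz, ← integral_indicator hA, ← integral_const_mul, ← integral_neg]
    congr 3
    ext x
    by_cases hx : x + t ∈ B
    · simp [hx, indicator]; ring
    · simp [hx, indicator]

/-- Test functions see only bounded sets, so the total mean is reached by monotone convergence along
`[0, n]`. -/
lemma IsOffspringFamily.lintegral_univ (hQ : IsOffspringFamily h Q) (hh : Measurable h)
    (hα : ∫⁻ x, (h x : ℝ≥0∞) ∂lebesgue < ∞) (t : ℝ≥0) :
    ∫⁻ ν, ν univ ∂Q t = ∫⁻ x, (h x : ℝ≥0∞) ∂lebesgue := by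
  have hmono : Monotone fun n : ℕ => Iic (n : ℝ≥0) := fun m n hmn =>
    Iic_subset_Iic.2 (by exact_mod_cast hmn)
  have hU : (univ : Set ℝ≥0) = ⋃ n : ℕ, Iic (n : ℝ≥0) := by
    ext x
    simpa using exists_nat_ge x
  have hU' : (univ : Set ℝ≥0) = ⋃ n : ℕ, {x : ℝ≥0 | x + t ∈ Iic (n : ℝ≥0)} := by
    ext x
    simpa using exists_nat_ge (x + t)
  have hmono' : Monotone fun n : ℕ => {x : ℝ≥0 | x + t ∈ Iic (n : ℝ≥0)} := fun m n hmn x hx =>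
    hmono hmn hx
  have h1 : ∫⁻ ν, ν univ ∂Q t = ⨆ n : ℕ, ∫⁻ ν, ν (Iic (n : ℝ≥0)) ∂Q t := by
    rw [← lintegral_iSup (fun n => Measure.measurable_coe measurableSet_Iic)
      fun m n hmn ν => measure_mono (hmono hmn)]
    refine lintegral_congr fun ν => ?_
    rw [hU, hmono.measure_iUnion]
  have h2 : ∫⁻ x, (h x : ℝ≥0∞) ∂lebesgue =
      ⨆ n : ℕ, ∫⁻ x in {x : ℝ≥0 | x + t ∈ Iic (n : ℝ≥0)}, (h x : ℝ≥0∞) ∂lebesgue := by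
    rw [← setLIntegral_univ, hU', setLIntegral_iUnion_of_directed _ hmono'.directed_le]
  rw [h1, h2]
  exact iSup_congr fun n =>
    hQ.lintegral_apply hh hα t measurableSet_Iic (nnreal_isBounded_Iic _)

lemma IsOffspringFamily.ae_Iio_eq_zero (hQ : IsOffspringFamily h Q) (hh : Measurable h)
    (hα : ∫⁻ x, (h x : ℝ≥0∞) ∂lebesgue < ∞) (t : ℝ≥0) : ∀ᵐ ν ∂Q t, ν (Iio t) = 0 := by
  refine (lintegral_eq_zero_iff (Measure.measurable_coe measurableSet_Iio)).1 ?_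
  rw [hQ.lintegral_apply hh hα t measurableSet_Iio (nnreal_isBounded_Iio _)]
  simp

end Offspring

/-! ### Existence of the offspring processes -/

lemma measurable_expNeg : Measurable expNeg :=
  EReal.measurable_exp.comp measurable_coe_ennreal_ereal.neg

lemma lintegral_pi_prod_eq_pow {α : Type*} [MeasurableSpace α] (μ : Measure α) [SigmaFinite μ]
    {g : α → ℝ≥0∞} (hg : Measurable g) (k : ℕ) :
    ∫⁻ x, ∏ i, g (x i) ∂(Measure.pi fun _ : Fin k => μ) = (∫⁻ x, g x ∂μ) ^ k := by
  induction k with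
  | zero => simp
  | succ k ih =>
    have hm : Measurable fun y : Fin k → α => ∏ i, g (y i) :=
      Finset.measurable_prod _ fun i _ => hg.comp (measurable_pi_apply i)
    have hm' : Measurable fun y : Fin (k + 1) → α => ∏ i, g (y i) :=
      Finset.measurable_prod _ fun i _ => hg.comp (measurable_pi_apply i)
    rw [← (measurePreserving_piFinSuccAbove (fun _ : Fin (k + 1) => μ) 0).symm.lintegral_comp hm']
    simp_rw [MeasurableEquiv.piFinSuccAbove_symm_apply, Fin.insertNthEquiv,
      Fin.prod_univ_succ, Fin.insertNth_zero, Equiv.coe_fn_mk, Fin.cons_succ, Fin.cons_zero]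
    rw [pow_succ', ← ih]
    exact lintegral_prod_mul hg.aemeasurable hm.aemeasurable

lemma tsum_exp_neg_div_factorial_mul_pow (a : ℝ) {b : ℝ} (hb : 0 ≤ b) :
    ∑' k : ℕ, ENNReal.ofReal (Real.exp (-a) / k.factorial) * ENNReal.ofReal b ^ k =
      ENNReal.ofReal (Real.exp (b - a)) := by
  have hs : HasSum (fun k : ℕ => Real.exp (-a) / k.factorial * b ^ k) (Real.exp (b - a)) := by
    have := (NormedSpace.expSeries_div_hasSum_exp b).mul_left (Real.exp (-a))
    rw [← Real.exp_eq_exp_ℝ, ← Real.exp_add] at this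
    rw [show b - a = -a + b by ring]
    convert! this using 2 with k
    rw [div_mul_eq_mul_div, mul_div_assoc]
  rw [← hs.tsum_eq, ENNReal.ofReal_tsum_of_nonneg (fun k => by positivity) hs.summable]
  refine tsum_congr fun k => ?_
  rw [ENNReal.ofReal_mul (by positivity), ENNReal.ofReal_pow hb]

/-- The counting measure with points `t + x i`. -/
noncomputable def shiftedPoints (k : ℕ) (p : ℝ≥0 × (Fin k → ℝ≥0)) : Measure ℝ≥0 :=
  ∑ i, Measure.dirac (p.2 i + p.1)

lemma measurable_shiftedPoints (k : ℕ) : Measurable (shiftedPoints k) := by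
  refine Measure.measurable_of_measurable_coe _ fun s hs => ?_
  simp only [shiftedPoints, Measure.finsetSum_apply]
  refine Finset.measurable_sum _ fun i _ => ?_
  exact (Measure.measurable_coe hs).comp (Measure.measurable_dirac.comp
    (((measurable_pi_apply i).comp measurable_snd).add measurable_fst))

lemma isCounting_shiftedPoints (k : ℕ) (p : ℝ≥0 × (Fin k → ℝ≥0)) :
    IsCounting (shiftedPoints k p) := by
  intro B hB hb
  choose n hn using fun i => isCounting_dirac (p.2 i + p.1) B hB hb
  refine ⟨∑ i, n i, ?_⟩
  simp only [shiftedPoints, Measure.finsetSum_apply, hn]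
  push_cast
  rfl

variable (lam : Measure ℝ≥0) [IsFiniteMeasure lam]

/-- The kernel sending `t` to the law of the translate by `t` of a Poisson process with finite
intensity measure `lam`. -/
noncomputable def poissonFamily : Kernel ℝ≥0 (Measure ℝ≥0) where
  -- Given `k` points, they are i.i.d. with law `lam` normalised. The Poisson weight `exp (-m) * m ^
  -- k / k!`, with `m` the mass of `lam`, absorbs the normalisation `m ^ (-k)`, so no division by
  -- `m` occurs and `lam = 0` is allowed.
  toFun t := Measure.sum fun k : ℕ =>
    ENNReal.ofReal (Real.exp (-lam.real univ) / k.factorial) •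
      (Measure.pi fun _ : Fin k => lam).map fun x => shiftedPoints k (t, x)
  measurable' := by
    refine Measure.measurable_of_measurable_coe _ fun s hs => ?_
    simp_rw [Measure.sum_apply _ hs, Measure.smul_apply, smul_eq_mul]
    refine Measurable.tsum fun k => Measurable.const_mul ?_ _
    have : ∀ t : ℝ≥0, ((Measure.pi fun _ : Fin k => lam).map
        fun x => shiftedPoints k (t, x)) s =
        (Measure.pi fun _ : Fin k => lam) (Prod.mk t ⁻¹' (shiftedPoints k ⁻¹' s)) := fun t =>
      Measure.map_apply ((measurable_shiftedPoints k).comp measurable_prodMk_left) hs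
    simp_rw [this]
    exact measurable_measure_prodMk_left (measurable_shiftedPoints k hs)

lemma lintegral_poissonFamily (t : ℝ≥0) {F : Measure ℝ≥0 → ℝ≥0∞} (hF : Measurable F) :
    ∫⁻ ν, F ν ∂poissonFamily lam t =
      ∑' k : ℕ, ENNReal.ofReal (Real.exp (-lam.real univ) / k.factorial) *
        ∫⁻ x, F (shiftedPoints k (t, x)) ∂(Measure.pi fun _ : Fin k => lam) := by
  change ∫⁻ ν, F ν ∂(Measure.sum _) = _
  rw [lintegral_sum_measure]
  refine tsum_congr fun k => ?_
  have hm : Measurable fun x => shiftedPoints k (t, x) :=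
    (measurable_shiftedPoints k).comp measurable_prodMk_left
  rw [lintegral_smul_measure, lintegral_map hF hm, smul_eq_mul]

instance : IsMarkovKernel (poissonFamily lam) := by
  refine ⟨fun t => ⟨?_⟩⟩
  have h := lintegral_poissonFamily lam t (F := fun _ => 1) measurable_const
  simp only [lintegral_const, one_mul, Measure.pi_univ, Finset.prod_const, Finset.card_univ,
    Fintype.card_fin] at h
  rw [h, ← ofReal_measureReal, tsum_exp_neg_div_factorial_mul_pow _ measureReal_nonneg]
  simp

lemma isPointProcess_poissonFamily (t : ℝ≥0) : IsPointProcess (poissonFamily lam t) := by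
  refine ⟨inferInstance, ?_⟩
  change ∀ᵐ ν ∂(Measure.sum _), IsCounting ν
  rw [Measure.ae_sum_iff]
  refine fun k => Measure.ae_smul_measure ?_ _
  have hm : Measurable fun x => shiftedPoints k (t, x) :=
    (measurable_shiftedPoints k).comp measurable_prodMk_left
  rw [ae_map_iff hm.aemeasurable measurableSet_isCounting]
  exact Filter.Eventually.of_forall fun x => isCounting_shiftedPoints k (t, x)

/-- With `k` points the functional is `∏ z (x i + t)`, whose integral is a `k`-th power by Tonelli;
the exponential series then sums the mixture. -/
lemma pgfl_poissonFamily (t : ℝ≥0) {z : ℝ≥0 → ℝ≥0} (hz : Measurable z) (hz1 : ∀ x, z x ≤ 1) :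
    pgfl (poissonFamily lam t) z =
      ENNReal.ofReal (Real.exp (∫ x, ((z (x + t) : ℝ) - 1) ∂lam)) := by
  have hl : Measurable fun x => (-ENNReal.log (z x)).toENNReal :=
    (hz.coe_nnreal_ennreal.ennreal_log.neg).ereal_toENNReal
  have hzt : Measurable fun x => z (x + t) := hz.comp (measurable_add_const t)
  have hint : Integrable (fun x => (z (x + t) : ℝ)) lam :=
    Integrable.of_bound hzt.coe_nnreal_real.aestronglyMeasurable 1
      (Filter.Eventually.of_forall fun x => by simpa using hz1 (x + t))
  have hb : ∫⁻ x, (z (x + t) : ℝ≥0∞) ∂lam = ENNReal.ofReal (∫ x, (z (x + t) : ℝ) ∂lam) := by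
    rw [ofReal_integral_eq_lintegral_ofReal hint
      (Filter.Eventually.of_forall fun x => NNReal.coe_nonneg _)]
    simp
  change ∫⁻ ν, expNeg (∫⁻ x, (-ENNReal.log (z x)).toENNReal ∂ν) ∂poissonFamily lam t = _
  have hm : Measurable fun ν => expNeg (∫⁻ x, (-ENNReal.log (z x)).toENNReal ∂ν) :=
    measurable_expNeg.comp (Measure.measurable_lintegral hl)
  rw [lintegral_poissonFamily lam t hm,
    integral_sub hint (integrable_const 1), integral_const, smul_eq_mul, mul_one,
    ← tsum_exp_neg_div_factorial_mul_pow _ (integral_nonneg fun x => NNReal.coe_nonneg _), ← hb]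
  refine tsum_congr fun k => ?_
  rw [← lintegral_pi_prod_eq_pow lam hzt.coe_nnreal_ennreal]
  congr 1
  refine lintegral_congr fun x => ?_
  simp only [shiftedPoints, lintegral_finsetSum_measure, lintegral_dirac' _ hl]
  rw [expNeg_sum]
  exact Finset.prod_congr rfl fun i _ => expNeg_neg_log (hz1 _)

lemma exists_isOffspringFamily {h : ℝ≥0 → ℝ≥0} (hh : Measurable h)
    (hα : ∫⁻ x, (h x : ℝ≥0∞) ∂lebesgue < ∞) :
    ∃ Q : Kernel ℝ≥0 (Measure ℝ≥0), IsMarkovKernel Q ∧ IsOffspringFamily h Q := by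
  have : IsFiniteMeasure (lebesgue.withDensity fun x => (h x : ℝ≥0∞)) :=
    isFiniteMeasure_withDensity hα.ne
  refine ⟨poissonFamily (lebesgue.withDensity fun x => (h x : ℝ≥0∞)), inferInstance,
    fun t => ⟨isPointProcess_poissonFamily _ t, fun z hz => ?_⟩⟩
  rw [pgfl_poissonFamily _ t hz.1 hz.2.1, integral_withDensity_eq_integral_smul hh]
  congr 3
  ext x
  rw [NNReal.smul_def, smul_eq_mul, mul_comm]

/-! ### Generations and clusters -/

section Cluster

variable (Q : Kernel ℝ≥0 (Measure ℝ≥0)) [IsMarkovKernel Q]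

/-- The law of the `n`-th generation of descendants of an immigrant at `t`. -/
noncomputable def generationLaw (t : ℝ≥0) (n : ℕ) : Measure (Measure ℝ≥0) :=
  (generations Q t).map fun x => x n

lemma generationLaw_zero (t : ℝ≥0) : generationLaw Q t 0 = Measure.dirac (Measure.dirac t) := by
  set κ : (n : ℕ) → Kernel (Finset.Iic n → Measure ℝ≥0) (Measure ℝ≥0) := fun n =>
    (superposition Q).comap (fun x => x ⟨n, Finset.mem_Iic.2 le_rfl⟩) (measurable_pi_apply _)
  have h := Kernel.traj_map_frestrictLe_apply (X := fun _ => Measure ℝ≥0) (κ := κ) 0 0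
    (fun _ => Measure.dirac t)
  rw [Kernel.partialTraj_self, Kernel.id_apply] at h
  have h2 := congrArg (Measure.map
    fun x : Finset.Iic 0 → Measure ℝ≥0 => x ⟨0, Finset.mem_Iic.2 le_rfl⟩) h
  rw [Measure.map_map (by fun_prop) (by fun_prop), Measure.map_dirac' (by fun_prop)] at h2
  exact h2

/-- The transition kernel reads only the last coordinate of the history, so the one-dimensional
marginals satisfy a Markov recursion. -/
lemma generationLaw_succ (t : ℝ≥0) (n : ℕ) :
    generationLaw Q t (n + 1) = (generationLaw Q t n).bind (superposition Q) := by
  set κ : (n : ℕ) → Kernel (Finset.Iic n → Measure ℝ≥0) (Measure ℝ≥0) := fun n =>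
    (superposition Q).comap (fun x => x ⟨n, Finset.mem_Iic.2 le_rfl⟩) (measurable_pi_apply _)
    with hκ
  have : ∀ n, IsMarkovKernel (κ n) := fun n => by simp only [hκ]; infer_instance
  have h := Kernel.partialTraj_compProd_eq_map_traj (X := fun _ => Measure ℝ≥0) (κ := κ)
    (Nat.zero_le n) (x₀ := fun _ => Measure.dirac t)
  have h2 := congrArg Measure.snd h
  rw [Measure.snd_compProd, Measure.snd, Measure.map_map (by fun_prop) (by fun_prop),
    ← Kernel.traj_map_frestrictLe_apply] at h2
  refine Eq.trans (Eq.trans ?_ h2.symm) ?_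
  · rfl
  · have hm : Measurable fun x : ℕ → Measure ℝ≥0 => x n := by fun_prop
    have hm' : Measurable fun x : Finset.Iic n → Measure ℝ≥0 =>
      x ⟨n, Finset.mem_Iic.2 le_rfl⟩ := by fun_prop
    ext s hs
    rw [Measure.bind_apply hs (κ n).measurable.aemeasurable,
      Measure.bind_apply hs (superposition Q).measurable.aemeasurable, generationLaw,
      lintegral_map ((superposition Q).measurable_coe hs) hm,
      lintegral_map ((κ n).measurable_coe hs) (by fun_prop)]
    rfl

variable {Q} {a : ℝ≥0∞}

lemma generationLaw_properties (ha : a ≠ ∞) (hQ : ∀ t, ∀ᵐ ν ∂Q t, IsCounting ν)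
    (hQa : ∀ t, ∫⁻ ν, ν univ ∂Q t = a) (hQ0 : ∀ t, ∀ᵐ ν ∂Q t, ν (Iio t) = 0) (t : ℝ≥0) (n : ℕ) :
    (∀ᵐ ν ∂generationLaw Q t n, IsCounting ν) ∧ (∫⁻ ν, ν univ ∂generationLaw Q t n = a ^ n) ∧
      ∀ᵐ ν ∂generationLaw Q t n, ν (Iio t) = 0 := by
  have hmu : Measurable fun ν : Measure ℝ≥0 => ν univ := Measure.measurable_coe MeasurableSet.univ
  have hmt : MeasurableSet {ν : Measure ℝ≥0 | ν (Iio t) = 0} :=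
    Measure.measurable_coe measurableSet_Iio (measurableSet_singleton 0)
  induction n with
  | zero =>
    rw [generationLaw_zero, ae_dirac_iff measurableSet_isCounting,
      ae_dirac_iff hmt, lintegral_dirac' _ hmu]
    exact ⟨isCounting_dirac t, by simp, by simp⟩
  | succ n ih =>
    obtain ⟨h1, h2, h3⟩ := ih
    -- The finite mean of generation `n` makes it almost surely finite, which Wald's identity needs
    -- for generation `n + 1`.
    have hfin : ∀ᵐ μ ∂generationLaw Q t n, μ univ < ∞ :=
      ae_lt_top hmu (by rw [h2]; exact ENNReal.pow_ne_top ha)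
    rw [generationLaw_succ]
    refine ⟨Measure.ae_comp_of_ae_ae measurableSet_isCounting ?_, ?_,
      Measure.ae_comp_of_ae_ae hmt ?_⟩
    · filter_upwards [h1, hfin] with μ hμ hf
      refine ae_isCounting_superposition hQ μ fun n => ?_
      refine (lintegral_mono fun ν => measure_mono (subset_univ _)).trans_lt ?_
      rw [lintegral_superposition_univ hQa hμ hf]
      exact ENNReal.mul_lt_top hf ha.lt_top
    · rw [Measure.lintegral_bind (superposition Q).measurable.aemeasurable hmu.aemeasurable,
        pow_succ, ← h2, ← lintegral_mul_const _ hmu]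
      refine lintegral_congr_ae ?_
      filter_upwards [h1, hfin] with μ hμ hf using lintegral_superposition_univ hQa hμ hf
    · filter_upwards [h3] with μ hμ using ae_superposition_Iio_eq_zero hQ0 hμ

lemma ae_generations {p : Measure ℝ≥0 → Prop} {t : ℝ≥0}
    (hp : ∀ n, ∀ᵐ ν ∂generationLaw Q t n, p ν) : ∀ᵐ x ∂generations Q t, ∀ n, p (x n) :=
  ae_all_iff.2 fun n => ae_of_ae_map (measurable_pi_apply n).aemeasurable (hp n)

lemma cluster_apply (t : ℝ≥0) : cluster Q t = (generations Q t).map Measure.sum :=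
  Kernel.map_apply _ measurable_sum _

lemma lintegral_cluster_univ (ha : a ≠ ∞) (hQ : ∀ t, ∀ᵐ ν ∂Q t, IsCounting ν)
    (hQa : ∀ t, ∫⁻ ν, ν univ ∂Q t = a) (hQ0 : ∀ t, ∀ᵐ ν ∂Q t, ν (Iio t) = 0) (t : ℝ≥0) :
    ∫⁻ ν, ν univ ∂cluster Q t = (1 - a)⁻¹ := by
  have hmu : Measurable fun ν : Measure ℝ≥0 => ν univ := Measure.measurable_coe MeasurableSet.univ
  rw [cluster_apply, lintegral_map hmu measurable_sum]
  simp_rw [Measure.sum_apply _ MeasurableSet.univ]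
  have hm : ∀ i : ℕ, Measurable fun m : ℕ → Measure ℝ≥0 => m i univ := fun i =>
    hmu.comp (measurable_pi_apply i)
  rw [lintegral_tsum fun i => (hm i).aemeasurable, ← ENNReal.tsum_geometric]
  refine tsum_congr fun n => ?_
  rw [← (generationLaw_properties ha hQ hQa hQ0 t n).2.1, generationLaw,
    lintegral_map hmu (measurable_pi_apply n)]

lemma ae_cluster_Iio_eq_zero (ha : a ≠ ∞) (hQ : ∀ t, ∀ᵐ ν ∂Q t, IsCounting ν)
    (hQa : ∀ t, ∫⁻ ν, ν univ ∂Q t = a) (hQ0 : ∀ t, ∀ᵐ ν ∂Q t, ν (Iio t) = 0) (t : ℝ≥0) :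
    ∀ᵐ ν ∂cluster Q t, ν (Iio t) = 0 := by
  have hmt : MeasurableSet {ν : Measure ℝ≥0 | ν (Iio t) = 0} :=
    Measure.measurable_coe measurableSet_Iio (measurableSet_singleton 0)
  rw [cluster_apply, ae_map_iff measurable_sum.aemeasurable hmt]
  filter_upwards [ae_generations fun n => (generationLaw_properties ha hQ hQa hQ0 t n).2.2]
    with x hx
  simp [Measure.sum_apply _ measurableSet_Iio, hx]

lemma ae_cluster_univ_lt_top (ha : a < 1) (hQ : ∀ t, ∀ᵐ ν ∂Q t, IsCounting ν)
    (hQa : ∀ t, ∫⁻ ν, ν univ ∂Q t = a) (hQ0 : ∀ t, ∀ᵐ ν ∂Q t, ν (Iio t) = 0) (t : ℝ≥0) :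
    ∀ᵐ ν ∂cluster Q t, ν univ < ∞ := by
  refine ae_lt_top (Measure.measurable_coe MeasurableSet.univ) ?_
  rw [lintegral_cluster_univ ha.ne_top hQ hQa hQ0, ENNReal.inv_ne_top]
  exact (tsub_pos_of_lt ha).ne'

lemma isPointProcess_cluster (ha : a < 1) (hQ : ∀ t, ∀ᵐ ν ∂Q t, IsCounting ν)
    (hQa : ∀ t, ∫⁻ ν, ν univ ∂Q t = a) (hQ0 : ∀ t, ∀ᵐ ν ∂Q t, ν (Iio t) = 0) (t : ℝ≥0) :
    IsPointProcess (cluster Q t) := by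
  refine ⟨inferInstance, ?_⟩
  have hfin := ae_cluster_univ_lt_top ha hQ hQa hQ0 t
  rw [cluster_apply] at hfin ⊢
  rw [ae_map_iff measurable_sum.aemeasurable measurableSet_isCounting]
  filter_upwards [ae_of_ae_map measurable_sum.aemeasurable hfin,
    ae_generations fun n => (generationLaw_properties ha.ne_top hQ hQa hQ0 t n).1] with x h1 h2
  exact isCounting_sum h2 fun n => (measure_mono (subset_univ _)).trans_lt h1

end Cluster

/-- A cluster process whose centre process is a point process is a point process if the satellite
processes are point processes of bounded mean size without points before their centres. -/
lemma isPointProcess_clusterLaw {Q : Kernel ℝ≥0 (Measure ℝ≥0)} [IsMarkovKernel Q]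
    {Lc : Measure (Measure ℝ≥0)} (hL : IsPointProcess Lc) {b : ℝ≥0∞} (hb : b ≠ ∞)
    (hQ : ∀ t, ∀ᵐ ν ∂Q t, IsCounting ν) (hQb : ∀ t, ∫⁻ ν, ν univ ∂Q t ≤ b)
    (hQ0 : ∀ t, ∀ᵐ ν ∂Q t, ν (Iio t) = 0) : IsPointProcess (clusterLaw Lc Q) := by
  have := hL.1
  refine ⟨?_, Measure.ae_comp_of_ae_ae measurableSet_isCounting ?_⟩
  · unfold clusterLaw; infer_instance
  · filter_upwards [hL.2] with μ hμ
    exact ae_isCounting_superposition hQ μ fun n =>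
      lintegral_superposition_Iic_lt_top hb hQb hQ0 hμ n

/-! ### The renewal process -/

section Renewal

variable {Ω : Type*} [MeasurableSpace Ω] {P : Measure Ω} {τ : ℕ → Ω → ℝ≥0} {f : ℝ≥0 → ℝ≥0}

lemma measurable_renewalProcess (hτ : ∀ i, Measurable (τ i)) : Measurable (renewalProcess τ) :=
  measurable_sum.comp <| measurable_pi_lambda _ fun _ =>
    Measure.measurable_dirac.comp (Finset.measurable_sum _ fun i _ => hτ i)

lemma lebesgue_singleton (x : ℝ≥0) : lebesgue {x} = 0 := by
  rw [lebesgue, NNReal.isClosedEmbedding_coe.measurableEmbedding.comap_apply]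
  simp

/-- By independence `E exp (-S_n) = r ^ n` with `r = E exp (-τ 0)`. Once `r < 1`, the series `∑ exp
(-S_n)` has finite mean, hence converges almost surely, and this leaves finitely many `S_n` in any
bounded set. -/
lemma isPointProcess_renewalProcess [IsProbabilityMeasure P] (hτ : IsInterarrivalSequence P τ f) :
    IsPointProcess (P.map (renewalProcess τ)) := by
  have hmeas := measurable_renewalProcess hτ.measurable
  refine ⟨Measure.isProbabilityMeasure_map hmeas.aemeasurable, ?_⟩
  rw [ae_map_iff hmeas.aemeasurable measurableSet_isCounting]
  set g : ℝ≥0 → ℝ≥0∞ := fun x => ENNReal.ofReal (Real.exp (-(x : ℝ))) with hg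
  have hgm : Measurable g := by fun_prop
  have hgS : ∀ n ω, g (∑ i ∈ Finset.range n, τ i ω) = ∏ i ∈ Finset.range n, g (τ i ω) := by
    intro n ω
    simp only [hg]
    rw [← ENNReal.ofReal_prod_of_nonneg fun i _ => (Real.exp_pos _).le, ← Real.exp_sum]
    simp
  have hgSm : ∀ n, Measurable fun ω => g (∑ i ∈ Finset.range n, τ i ω) := fun n =>
    hgm.comp (Finset.measurable_sum _ fun i _ => hτ.measurable i)
  set r : ℝ≥0∞ := ∫⁻ ω, g (τ 0 ω) ∂P with hr
  have hri : ∀ i, ∫⁻ ω, g (τ i ω) ∂P = r := fun i => by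
    rw [hr, ← lintegral_map hgm (hτ.measurable i), ← lintegral_map hgm (hτ.measurable 0),
      hτ.law, hτ.law]
  -- The density excludes an atom at `0`; this is what makes `r` strictly less than `1`.
  have hpos : ∀ᵐ ω ∂P, τ 0 ω ≠ 0 := by
    refine ae_of_ae_map (p := fun x => x ≠ 0) (hτ.measurable 0).aemeasurable ?_
    rw [hτ.law]
    have h0 : ∀ᵐ x ∂lebesgue, x ≠ 0 := by
      rw [ae_iff]
      simpa using lebesgue_singleton 0
    exact (withDensity_absolutelyContinuous _ _).ae_le h0
  have hr1 : r < 1 := by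
    have h1 : ∫⁻ _, 1 ∂P = 1 := by simp
    have hlt : ∀ᵐ ω ∂P, g (τ 0 ω) < 1 := hpos.mono fun ω hω => by
      simp only [hg]
      rw [ENNReal.ofReal_lt_one, Real.exp_lt_one_iff, neg_lt_zero]
      exact NNReal.coe_pos.2 (pos_iff_ne_zero.2 hω)
    have hle : r ≤ 1 := h1 ▸ lintegral_mono_ae (hlt.mono fun ω => le_of_lt)
    have := lintegral_strict_mono (μ := P) (f := fun ω => g (τ 0 ω)) (g := fun _ => 1)
      (IsProbabilityMeasure.ne_zero P) aemeasurable_const (hle.trans_lt ENNReal.one_lt_top).ne hlt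
    rwa [h1] at this
  have hsum : ∫⁻ ω, ∑' n, g (∑ i ∈ Finset.range n, τ i ω) ∂P = (1 - r)⁻¹ := by
    rw [lintegral_tsum fun n => (hgSm n).aemeasurable, ← ENNReal.tsum_geometric]
    refine tsum_congr fun n => ?_
    simp_rw [hgS]
    rw [lintegral_prod_eq_prod_lintegral_of_indepFun _ (fun i ω => g (τ i ω))
      (hτ.indep.comp (fun _ => g) fun _ => hgm) fun i => hgm.comp (hτ.measurable i)]
    simp [hri]
  have hfin : ∀ᵐ ω ∂P, ∑' n, g (∑ i ∈ Finset.range n, τ i ω) < ∞ := by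
    refine ae_lt_top ?_ ?_
    · exact Measurable.tsum hgSm
    · rw [hsum, ENNReal.inv_ne_top]
      exact (tsub_pos_of_lt hr1).ne'
  filter_upwards [hfin] with ω hω
  refine isCounting_sum (fun n => isCounting_dirac _) fun n => ?_
  -- Chernoff's bound term by term: the indicator of `S_k ≤ n` is at most `exp n * exp (-S_k)`.
  have hmul : Measure.sum (fun k : ℕ => Measure.dirac (∑ i ∈ Finset.range k, τ i ω))
      (Iic (n : ℝ≥0)) ≤ ENNReal.ofReal (Real.exp n) * ∑' k, g (∑ i ∈ Finset.range k, τ i ω) := by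
    rw [Measure.sum_apply _ measurableSet_Iic, ← ENNReal.tsum_mul_left]
    refine ENNReal.tsum_le_tsum fun k => ?_
    rw [Measure.dirac_apply' _ measurableSet_Iic]
    refine indicator_apply_le' (fun hx => ?_) fun _ => zero_le
    simp only [hg]
    rw [← ENNReal.ofReal_mul (Real.exp_pos _).le, ← Real.exp_add, Pi.one_apply,
      ENNReal.one_le_ofReal, Real.one_le_exp_iff]
    have : ((∑ i ∈ Finset.range k, τ i ω : ℝ≥0) : ℝ) ≤ n := by exact_mod_cast mem_Iic.1 hx
    linarith
  exact hmul.trans_lt (ENNReal.mul_lt_top ENNReal.ofReal_lt_top hω)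

end Renewal

end RenewalHawkes

open RenewalHawkes in
theorem mainTheorem1
    -- the fertility function: nonnegative, measurable, of integral less than one
    (h : ℝ≥0 → ℝ≥0) (hh : Measurable h)
    (hα : ∫⁻ x, (h x : ℝ≥0∞) ∂(RenewalHawkes.lebesgue) < 1)
    -- the renewal process
    {Ω : Type*} [MeasurableSpace Ω] (P : Measure Ω) [IsProbabilityMeasure P]
    (τ : ℕ → Ω → ℝ≥0) (f : ℝ≥0 → ℝ≥0)
    (hτ : RenewalHawkes.IsInterarrivalSequence P τ f) :
    (∃ Q : Kernel ℝ≥0 (Measure ℝ≥0), IsMarkovKernel Q ∧ RenewalHawkes.IsOffspringFamily h Q) ∧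
    ∀ (Q : Kernel ℝ≥0 (Measure ℝ≥0)) [IsMarkovKernel Q], RenewalHawkes.IsOffspringFamily h Q →
      -- the cluster process exists
      RenewalHawkes.ClusterProcessExists (P.map (RenewalHawkes.renewalProcess τ))
        (RenewalHawkes.cluster Q) ∧
      -- its clusters are almost surely finite
      (∀ t₀, ∀ᵐ ν ∂(RenewalHawkes.cluster Q t₀), ν Set.univ < ∞) ∧
      -- the expected size of each cluster
      (∀ t₀, ∫⁻ ν, ν Set.univ ∂(RenewalHawkes.cluster Q t₀) =
        (1 - ∫⁻ x, (h x : ℝ≥0∞) ∂(RenewalHawkes.lebesgue))⁻¹) := by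
  have hα' := hα.trans ENNReal.one_lt_top
  refine ⟨exists_isOffspringFamily hh hα', fun Q _ hQ => ?_⟩
  have h1 : ∀ t, ∀ᵐ ν ∂Q t, IsCounting ν := fun t => (hQ t).1.2
  have h2 := hQ.lintegral_univ hh hα'
  have h3 := hQ.ae_Iio_eq_zero hh hα'
  have hmean := lintegral_cluster_univ hα'.ne h1 h2 h3
  have hpp := isPointProcess_cluster hα h1 h2 h3
  have hren := isPointProcess_renewalProcess hτ
  refine ⟨⟨hren, hpp, ?_⟩, ae_cluster_univ_lt_top hα h1 h2 h3, hmean⟩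
  refine isPointProcess_clusterLaw hren (b := (1 - ∫⁻ x, (h x : ℝ≥0∞) ∂lebesgue)⁻¹) ?_
    (fun t => (hpp t).2) (fun t => (hmean t).le) (ae_cluster_Iio_eq_zero hα'.ne h1 h2 h3)
  exact ENNReal.inv_ne_top.2 (tsub_pos_of_lt hα).ne'
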